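/- **Conventions.** Let $\mathbb{Q}$ be the real quaternions. A quaternion is written uniquely as $a=c_1+\mathbf{j}c_2$ with $c_1,c_2\in\mathbb{C}=\mathbb{R}+\mathbb{R}\mathbf{i}$; accordingly a tensor $\mathcal A\in\mathbb{Q}^{n_1\times n_2\times n_3}$ ($n_3\ge 1$) with frontal slices $\mathcal A^{(1)},\dots,\mathcal A^{(n_3)}\in\mathbb{Q}^{n_1\times n_2}$ is $\mathcal A=\mathcal A_{\mathbf d}+\mathbf{j}\mathcal A_{\mathbf c}$ with complex $\mathcal A_{\mathbf d},\mathcal A_{\mathbf c}$. Let $\mathrm{bcirc}(\mathcal C)$ be the block circulant matrix whose block $(p,q)$ is the frontal slice $\mathcal C^{(p-q+1)}$ (slice indices modulo $n_3$), let $P_{n_3}$ be the permutation matrix with entry $1$ at $(p,q)$ exactly when $p+q\equiv 2 \pmod{n_3}$, and put $$\mathrm{bcirc}_z(\mathcal A)=\mathrm{bcirc}(\mathcal A_{\mathbf d})+\mathbf{j}\,\mathrm{bcirc}(\mathcal A_{\mathbf c})(P_{n_3}\otimes I_{n_2})\in\mathbb{Q}^{n_1n_3\times n_2n_3}.$$ With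 $\mathrm{unfold}(\mathcal B)$ the block column of the frontal slices of $\mathcal B$ and $\mathrm{fold}$ its inverse, the QT-product is $\mathcal A*_Q\mathcal B=\mathrm{fold}(\mathrm{bcirc}_z(\mathcal A)\,\mathrm{unfold}(\mathcal B))$. The identity tensor $\mathcal I$ has first frontal slice $I_n$ and other slices $0$; powers and (two-sided) inverses of tensors in $\mathbb{Q}^{n\times n\times n_3}$ are taken with respect to $*_Q$ and $\mathcal I$. **QT-index and QT-Drazin inverse.** Put $\operatorname{rank}_{QT}(\mathcal A)=\operatorname{rank}(\mathrm{bcirc}_z(\mathcal A))$, the dimension of the right $\mathbb{Q}$-vector space spanned by the columns. For $\mathcal A\in\mathbb{Q}^{n\times n\times n_3}$, the QT-index $\operatorname{Ind}_{QT}(\mathcal A)$ is the least integer $k\ge 0$ with $\operatorname{rank}_{QT}(\mathcal A^{k+1})=\operatorname{rank}_{QT}(\mathcal A^{k})$. If $\operatorname{Ind}_{QT}(\mathcal A)=k$, a QT-Drazin inverse of $\mathcal A$ is a tensor $\mathcal X\in\mathbb{Q}^{n\times n\times n_3}$ with $\mathcal A^k*_Q\mathcal X*_Q\mathcal A=\mathcal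 A^k$, $\mathcal X*_Q\mathcal A*_Q\mathcal X=\mathcal X$ and $\mathcal A*_Q\mathcal X=\mathcal X*_Q\mathcal A$. **QT-Jordan form.** Let $\omega=e^{-2\pi\mathbf{i}/n_3}$ and $\hat{\mathcal A}^{(s)}=\sum_{t=1}^{n_3}\omega^{(s-1)(t-1)}\mathcal A^{(t)}$ for $1\le s\le n_3$. A quaternion Jordan matrix is a block diagonal matrix of upper Jordan blocks whose eigenvalues are complex numbers with nonnegative imaginary part. A tensor $\mathcal J\in\mathbb{Q}^{n\times n\times n_3}$ is a QT-Jordan form of $\mathcal A$ if, for every $s$, $\hat{\mathcal J}^{(s)}$ is a quaternion Jordan matrix that is similar, over $\mathbb{Q}$, to $\hat{\mathcal A}^{(s)}$. **Theorem.** Let $\mathcal A\in\mathbb{Q}^{n\times n\times n_3}$ with $\operatorname{Ind}_{QT}(\mathcal A)=k$. Then $\mathcal A$ has a QT-Jordan form and exactly one QT-Drazin inverse $\mathcal A^D$. For every QT-Jordan form $\mathcal J$ of $\mathcal A$, the tensor $\mathcal J$ has exactly one QT-Drazin inverse $\mathcal J^D$, and there is an invertible tensor $\mathcal P\in\mathbb{Q}^{n\times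 n\times n_3}$ such that $$\mathcal A=\mathcal P*_Q\mathcal J*_Q\mathcal P^{-1}\qquad\text{and}\qquad \mathcal A^D=\mathcal P*_Q\mathcal J^D*_Q\mathcal P^{-1}.$$ -/

import Mathlib

open scoped Quaternion Kronecker

/-- Third-order quaternion tensors of size `n₁ × n₂ × n₃`, given by their frontal slices:
`A t i j` is the `(i, j)` entry of the slice number `t` (slices are numbered from `0`, and slice
indices are read modulo `n₃`). -/
abbrev QTensor (n₁ n₂ n₃ : ℕ) : Type := Fin n₃ → Matrix (Fin n₁) (Fin n₂) ℍ[ℝ]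

namespace QTensor

/-- The quaternion unit `j`. -/
def unitJ : ℍ[ℝ] := ⟨0, 0, 1, 0⟩

/-- The complex number `c₁ = a₀ + a₁ i` in the decomposition `a = c₁ + j c₂`. -/
def dPart (a : ℍ[ℝ]) : ℂ := ⟨a.re, a.imI⟩

/-- The complex number `c₂ = a₂ - a₃ i` in the decomposition `a = c₁ + j c₂`. -/
def cPart (a : ℍ[ℝ]) : ℂ := ⟨a.imJ, -a.imK⟩

theorem dPart_add_unitJ_mul_cPart (a : ℍ[ℝ]) :
    (dPart a : ℍ[ℝ]) + unitJ * (cPart a : ℍ[ℝ]) = a := by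
  ext <;> simp [Quaternion.re_mul, Quaternion.imI_mul, Quaternion.imJ_mul, Quaternion.imK_mul] <;>
    simp [dPart, cPart, unitJ]

/-- The block circulant matrix: the block in block row `p` and block column `q` is the frontal
slice with index `p - q` modulo `n₃`. Rows and columns are indexed by
`(block index, index inside the block)`. -/
def bcirc {R : Type*} {n₁ n₂ n₃ : ℕ} (C : Fin n₃ → Matrix (Fin n₁) (Fin n₂) R) :
    Matrix (Fin n₃ × Fin n₁) (Fin n₃ × Fin n₂) R :=
  Matrix.of fun p q => C (p.1 - q.1) p.2 q.2

/-- The permutation matrix `P_{n₃}`: its entry `(p, q)` (numbered from `0`) is `1` if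
`p + q = 0` modulo `n₃`, and `0` otherwise. -/
noncomputable def permP (n₃ : ℕ) [NeZero n₃] : Matrix (Fin n₃) (Fin n₃) ℍ[ℝ] :=
  Matrix.of fun p q => if p + q = 0 then 1 else 0

/-- The `z`-block circulant matrix
`bcirc_z(A) = bcirc(A_d) + j bcirc(A_c) (P_{n₃} ⊗ I)` of `A = A_d + j A_c`. -/
noncomputable def bcircz {n₁ n₂ n₃ : ℕ} [NeZero n₃] (A : QTensor n₁ n₂ n₃) :
    Matrix (Fin n₃ × Fin n₁) (Fin n₃ × Fin n₂) ℍ[ℝ] :=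
  bcirc (fun t => (A t).map fun a => (dPart a : ℍ[ℝ])) +
    unitJ • (bcirc (fun t => (A t).map fun a => (cPart a : ℍ[ℝ])) *
      (permP n₃ ⊗ₖ (1 : Matrix (Fin n₂) (Fin n₂) ℍ[ℝ])))

/-- The block column of the frontal slices. -/
def unfold {n₁ n₂ n₃ : ℕ} (A : QTensor n₁ n₂ n₃) : Matrix (Fin n₃ × Fin n₁) (Fin n₂) ℍ[ℝ] :=
  Matrix.of fun p j => A p.1 p.2 j

/-- The inverse of `unfold`. -/
def fold {n₁ n₂ n₃ : ℕ} (M : Matrix (Fin n₃ × Fin n₁) (Fin n₂) ℍ[ℝ]) : QTensor n₁ n₂ n₃ :=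
  fun t => Matrix.of fun i j => M (t, i) j

/-- The QT-product `A *_Q B`. -/
noncomputable def qtMul {n₁ r n₂ n₃ : ℕ} [NeZero n₃] (A : QTensor n₁ r n₃) (B : QTensor r n₂ n₃) :
    QTensor n₁ n₂ n₃ :=
  fold (bcircz A * unfold B)

/-- The QT-product of quaternion tensors. -/
scoped infixl:70 " *Q " => QTensor.qtMul

/-- The identity tensor: the first frontal slice is the identity matrix, the others vanish. -/
noncomputable def qtOne (n n₃ : ℕ) [NeZero n₃] : QTensor n n n₃ := fun t => if t = 0 then 1 else 0

/-- Powers with respect to the QT-product. -/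
noncomputable def qtPow {n n₃ : ℕ} [NeZero n₃] (A : QTensor n n n₃) : ℕ → QTensor n n n₃
  | 0 => qtOne n n₃
  | k + 1 => qtPow A k *Q A

/-- `Q` is the two-sided inverse of `P` with respect to the QT-product. -/
def IsQTInverse {n n₃ : ℕ} [NeZero n₃] (P Q : QTensor n n n₃) : Prop :=
  P *Q Q = qtOne n n₃ ∧ Q *Q P = qtOne n n₃

/-- The rank of a quaternion matrix: the dimension of the right `ℍ`-vector space spanned by its
columns (right scalar multiplication is the action of the opposite ring). -/
noncomputable def quatRank {ι κ : Type*} (M : Matrix ι κ ℍ[ℝ]) : ℕ :=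
  Module.finrank (ℍ[ℝ])ᵐᵒᵖ (Submodule.span (ℍ[ℝ])ᵐᵒᵖ (Set.range M.col))

/-- The QT-rank of a tensor, as the rank of its `z`-block circulant matrix. -/
noncomputable def qtRank {n₁ n₂ n₃ : ℕ} [NeZero n₃] (A : QTensor n₁ n₂ n₃) : ℕ :=
  quatRank (bcircz A)

/-- The QT-index: the least `k` such that `A^{k+1}` and `A^k` have the same QT-rank. -/
noncomputable def qtIndex {n n₃ : ℕ} [NeZero n₃] (A : QTensor n n n₃) : ℕ :=
  sInf {k : ℕ | qtRank (qtPow A (k + 1)) = qtRank (qtPow A k)}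

/-- `X` is a QT-Drazin inverse of `A`. -/
structure IsQTDrazinInverse {n n₃ : ℕ} [NeZero n₃] (A X : QTensor n n n₃) : Prop where
  pow_mul_mul : qtPow A (qtIndex A) *Q X *Q A = qtPow A (qtIndex A)
  mul_mul : X *Q A *Q X = X
  comm : A *Q X = X *Q A

/-- The discrete Fourier transform along the third mode: the slice number `s` of the transform is
`∑ₜ ω^{st} A^{(t)}` with `ω = exp(-2πi/n₃)`, the scalars acting from the left. These slices are the
diagonal blocks of `(F ⊗ I) bcirc_z(A) (F* ⊗ I)`, `F` being the normalized Fourier matrix. -/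
noncomputable def dft {n₁ n₂ n₃ : ℕ} (A : QTensor n₁ n₂ n₃) : QTensor n₁ n₂ n₃ :=
  fun s => ∑ t : Fin n₃,
    ((Complex.exp (-(2 * Real.pi * Complex.I) / n₃) ^ ((s : ℕ) * (t : ℕ)) : ℂ) : ℍ[ℝ]) • A t

/-- The upper Jordan block of size `d` with complex eigenvalue `z`. -/
noncomputable def jordanBlock (d : ℕ) (z : ℂ) : Matrix (Fin d) (Fin d) ℍ[ℝ] :=
  Matrix.of fun i j => if i = j then (z : ℍ[ℝ]) else if (j : ℕ) = i + 1 then 1 else 0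

/-- `M` is a quaternion Jordan matrix: block diagonal, with consecutive upper Jordan blocks whose
eigenvalues are complex numbers with nonnegative imaginary part. -/
def IsJordanMatrix {n : ℕ} (M : Matrix (Fin n) (Fin n) ℍ[ℝ]) : Prop :=
  ∃ (r : ℕ) (d : Fin r → ℕ) (z : Fin r → ℂ) (h : ∑ b, d b = n),
    (∀ b, 0 < d b) ∧ (∀ b, 0 ≤ (z b).im) ∧
    M = Matrix.reindex (finSigmaFinEquiv.trans (finCongr h)) (finSigmaFinEquiv.trans (finCongr h))
      (Matrix.blockDiagonal' fun b => jordanBlock (d b) (z b))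

/-- `J` is a Jordan canonical form of the quaternion matrix `M`: a quaternion Jordan matrix which is
similar to `M`. -/
def IsJordanForm {n : ℕ} (M J : Matrix (Fin n) (Fin n) ℍ[ℝ]) : Prop :=
  IsJordanMatrix J ∧
    ∃ S T : Matrix (Fin n) (Fin n) ℍ[ℝ], S * T = 1 ∧ T * S = 1 ∧ M = S * J * T

/-- `J` is a QT-Jordan canonical form of `A`: every frontal slice of the transform of `J` is a
Jordan canonical form of the corresponding slice of the transform of `A`. -/
def IsQTJordanForm {n n₃ : ℕ} (A J : QTensor n n n₃) : Prop :=
  ∀ s : Fin n₃, IsJordanForm (dft A s) (dft J s)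

end QTensor

/-! The discrete Fourier transform along the third mode is a bijection that turns `*Q` into
slicewise multiplication (`dft_qtMul`): square tensors become a product of `n₃` copies of the
quaternion matrix ring, a finite-dimensional real algebra. The permutation in bcirc_z is what makes
this work, because it compensates for the conjugation suffered by a complex scalar that moves past
j.

Jordan forms, and the similarities leading to them, can therefore be chosen slice by slice and
transformed back. A Drazin inverse is unique in any monoid, whatever exponents are used, and
conjugation preserves it, so the formula for the Drazin inverse of `A` follows from uniqueness. For
existence, equal QT-ranks of consecutive powers mean equal column spaces, hence `a ^ k = a ^ (k + 1)
* y` for some `y`; the minimal polynomial of `a` then provides such a `y` that commutes with `a`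
(`exists_commute_pow_eq_pow_succ_mul`).

The Jordan form of a quaternion matrix comes from three facts. Nilpotent maps over a division ring
split into chains. For an eigenvalue `z`, the real quadratic with roots `z` and its conjugate gives
an ℍ-linear polynomial in the map, to which Fitting's decomposition applies. On the part where this
polynomial is nilpotent, the eigenvalue is either real, hence central, or j interchanges the complex
generalized eigenspaces of `z` and its conjugate, so that a complex Jordan basis of one is a
quaternion basis of the whole. -/

open Module

/-! ### Jordan bases of nilpotent maps over a division ring -/

/-- A linear map has a Jordan basis with eigenvalues in `S`: the basis is partitioned into finitely
many chains on each of which the map acts as a single Jordan block. -/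
def HasJordanBasis {D V : Type*} [DivisionRing D] [AddCommGroup V] [Module D V]
    (f : V →ₗ[D] V) (S : Set D) : Prop :=
  ∃ (ι : Type) (_ : Fintype ι) (d : ι → ℕ) (z : ι → D) (b : Basis (Σ i, Fin (d i)) D V),
    (∀ i, 0 < d i) ∧ (∀ i, z i ∈ S) ∧
      (∀ i (j : Fin (d i)) (h : (j : ℕ) + 1 < d i),
        f (b ⟨i, j⟩) = z i • b ⟨i, j⟩ + b ⟨i, ⟨j + 1, h⟩⟩) ∧
      ∀ i (j : Fin (d i)), (j : ℕ) + 1 = d i → f (b ⟨i, j⟩) = z i • b ⟨i, j⟩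

section

variable {D V : Type*} [DivisionRing D] [AddCommGroup V] [Module D V]

theorem HasJordanBasis.of_subsingleton [Subsingleton V] (f : V →ₗ[D] V) (S : Set D) :
    HasJordanBasis f S :=
  ⟨Empty, inferInstance, fun _ => 0, fun _ => 0, Basis.empty V, fun i => i.elim, fun i => i.elim,
    fun i => i.elim, fun i => i.elim⟩

/-- Jordan bases of two complementary invariant subspaces form a Jordan basis. -/
theorem HasJordanBasis.of_isCompl {f : V →ₗ[D] V} {S : Set D} {U W : Submodule D V}
    (h : IsCompl U W) (hU : ∀ x ∈ U, f x ∈ U) (hW : ∀ x ∈ W, f x ∈ W)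
    (jU : HasJordanBasis (f.restrict hU) S) (jW : HasJordanBasis (f.restrict hW) S) :
    HasJordanBasis f S := by
  obtain ⟨ι, _, d, z, b, hd, hz, hb, hb0⟩ := jU
  obtain ⟨ι', _, d', z', b', hd', hz', hb', hb0'⟩ := jW
  let e : (Σ i, Fin (Sum.elim d d' i)) ≃ (Σ i, Fin (d i)) ⊕ (Σ i, Fin (d' i)) :=
    Equiv.sumSigmaDistrib fun i => Fin (Sum.elim d d' i)
  let B := ((b.prod b').map (Submodule.prodEquivOfIsCompl U W h)).reindex e.symm
  have hB : ∀ k, B k = (Submodule.prodEquivOfIsCompl U W h) ((b.prod b') (e k)) := fun k => by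
    rw [Basis.reindex_apply, Basis.map_apply, Equiv.symm_symm]
  have hBl : ∀ i (j : Fin (d i)), B ⟨Sum.inl i, j⟩ = b ⟨i, j⟩ := fun i j => by
    rw [hB, show e ⟨Sum.inl i, j⟩ = Sum.inl ⟨i, j⟩ from rfl]
    simp [Basis.prod_apply]
  have hBr : ∀ i (j : Fin (d' i)), B ⟨Sum.inr i, j⟩ = b' ⟨i, j⟩ := fun i j => by
    rw [hB, show e ⟨Sum.inr i, j⟩ = Sum.inr ⟨i, j⟩ from rfl]
    simp [Basis.prod_apply]
  refine ⟨ι ⊕ ι', inferInstance, Sum.elim d d', Sum.elim z z', B, ?_, ?_, ?_, ?_⟩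
  · rintro (i | i)
    exacts [hd i, hd' i]
  · rintro (i | i)
    exacts [hz i, hz' i]
  · rintro (i | i) j hj
    · have := congrArg Subtype.val (hb i j hj)
      rw [LinearMap.coe_restrict_apply, Submodule.coe_add, Submodule.coe_smul] at this
      exact (congrArg f (hBl i j)).trans (this.trans
        (congrArg₂ _ (congrArg _ (hBl i j).symm) (hBl _ _).symm))
    · have := congrArg Subtype.val (hb' i j hj)
      rw [LinearMap.coe_restrict_apply, Submodule.coe_add, Submodule.coe_smul] at this
      exact (congrArg f (hBr i j)).trans (this.trans
        (congrArg₂ _ (congrArg _ (hBr i j).symm) (hBr _ _).symm))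
  · rintro (i | i) j hj
    · have := congrArg Subtype.val (hb0 i j hj)
      rw [LinearMap.coe_restrict_apply, Submodule.coe_smul] at this
      exact (congrArg f (hBl i j)).trans (this.trans (congrArg _ (hBl i j).symm))
    · have := congrArg Subtype.val (hb0' i j hj)
      rw [LinearMap.coe_restrict_apply, Submodule.coe_smul] at this
      exact (congrArg f (hBr i j)).trans (this.trans (congrArg _ (hBr i j).symm))

theorem exists_linearMap_apply_eq_one {v : V} (hv : v ≠ 0) : ∃ φ : V →ₗ[D] D, φ v = 1 := by
  obtain ⟨φ, hφ⟩ := (LinearMap.toSpanSingleton D V v).exists_leftInverse_of_injective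
    (LinearMap.ker_toSpanSingleton D hv)
  exact ⟨φ, by simpa using LinearMap.congr_fun hφ 1⟩

theorem pow_apply_eq_zero_of_le {N : V →ₗ[D] V} {p k : ℕ} (hN : N ^ p = 0) (h : p ≤ k) (v : V) :
    (N ^ k) v = 0 := by
  rw [pow_eq_zero_of_le h hN, LinearMap.zero_apply]

/-- A chain of maximal length of a nilpotent map spans a subspace with an invariant complement. -/
theorem exists_isCompl_chain [Module.Finite D V] {N : V →ₗ[D] V} {p : ℕ}
    (hN : N ^ (p + 1) = 0) (hp : N ^ p ≠ 0) :
    ∃ U W : Submodule D V, ∃ hU : ∀ x ∈ U, N x ∈ U, IsCompl U W ∧ (∀ x ∈ W, N x ∈ W) ∧ U ≠ ⊥ ∧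
      HasJordanBasis (N.restrict hU) {0} := by
  obtain ⟨v, hv⟩ : ∃ v, (N ^ p) v ≠ 0 := by
    by_contra! h
    exact hp (LinearMap.ext h)
  obtain ⟨φ, hφ⟩ := exists_linearMap_apply_eq_one (D := D) hv
  let Ψ : (Fin (p + 1) → D) →ₗ[D] V := Fintype.linearCombination D fun j => (N ^ (j : ℕ)) v
  -- The complement is the kernel of `Φ`, the largest invariant subspace inside the kernel of `φ`.
  let Φ : V →ₗ[D] (Fin (p + 1) → D) := LinearMap.pi fun i => φ ∘ₗ N ^ (i : ℕ)
  have hΨ : ∀ c, Ψ c = ∑ j, c j • (N ^ (j : ℕ)) v := fun c => rfl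
  have hΨ1 : ∀ j, Ψ (Pi.single j 1) = (N ^ (j : ℕ)) v := fun j => by
    simp [Ψ, Fintype.linearCombination_apply_single]
  -- Coordinate `p - j` isolates `c j`: earlier coefficients vanish by induction, later terms
  -- contain a power of `N` beyond `p`.
  have key : ∀ c, Φ (Ψ c) = 0 → c = 0 := by
    intro c hc
    have : ∀ j : ℕ, ∀ h : j < p + 1, c ⟨j, h⟩ = 0 := by
      intro j
      induction j using Nat.strong_induction_on with
      | _ j ih =>
        intro h
        have h0 := congrFun hc ⟨p - j, by omega⟩
        have h1 : φ ((N ^ (p - j)) (Ψ c)) = 0 := h0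
        rw [hΨ, map_sum, map_sum, Finset.sum_eq_single ⟨j, h⟩] at h1
        · rw [map_smul, map_smul, ← Module.End.mul_apply, ← pow_add,
            show p - j + j = p by omega, hφ, smul_eq_mul, mul_one] at h1
          exact h1
        · intro k _ hk
          rw [map_smul, map_smul, ← Module.End.mul_apply, ← pow_add]
          rcases lt_or_ge (k : ℕ) j with hkj | hkj
          · rw [ih k hkj k.2, zero_smul]
          · have : (k : ℕ) ≠ j := fun e => hk (Fin.ext e)
            rw [pow_apply_eq_zero_of_le hN (by omega), map_zero, smul_zero]
        · simp
    exact funext fun j => this j j.2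
  have hinj : Function.Injective Ψ := by
    rw [← LinearMap.ker_eq_bot, LinearMap.ker_eq_bot']
    intro c hc
    exact key c (by rw [hc, map_zero])
  have hU : ∀ x ∈ LinearMap.range Ψ, N x ∈ LinearMap.range Ψ := by
    rintro _ ⟨c, rfl⟩
    rw [hΨ, map_sum]
    refine Submodule.sum_mem _ fun j _ => ?_
    rw [map_smul, ← Module.End.mul_apply, ← pow_succ']
    refine Submodule.smul_mem _ _ ?_
    rcases lt_or_ge ((j : ℕ) + 1) (p + 1) with h | h
    · exact ⟨_, hΨ1 ⟨j + 1, h⟩⟩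
    · rw [pow_apply_eq_zero_of_le hN h]
      exact Submodule.zero_mem _
  refine ⟨LinearMap.range Ψ, LinearMap.ker Φ, hU, ?_, ?_, ?_, ?_⟩
  · rw [Submodule.isCompl_iff_disjoint]
    · rw [Submodule.disjoint_def]
      rintro _ ⟨c, rfl⟩ hc
      rw [key c hc, map_zero]
    -- The range of `Ψ` has dimension `p + 1`, and the rank of `Φ` is at most `p + 1`.
    · rw [LinearMap.finrank_range_of_inj hinj, ← Φ.finrank_range_add_finrank_ker]
      exact Nat.add_le_add_right (Submodule.finrank_le _) _
  · intro x hx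
    rw [LinearMap.mem_ker] at hx ⊢
    funext i
    change φ ((N ^ (i : ℕ)) (N x)) = 0
    rw [← Module.End.mul_apply, ← pow_succ]
    rcases lt_or_ge ((i : ℕ) + 1) (p + 1) with h | h
    · exact congrFun hx ⟨i + 1, h⟩
    · rw [pow_apply_eq_zero_of_le hN h, map_zero]
  · intro h
    have : (N ^ p) v ∈ LinearMap.range Ψ := ⟨_, hΨ1 (Fin.last p)⟩
    rw [h, Submodule.mem_bot] at this
    exact hv this
  · let B := ((Pi.basisFun D (Fin (p + 1))).map (LinearEquiv.ofInjective Ψ hinj)).reindex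
        (Equiv.uniqueSigma fun _ : Unit => Fin (p + 1)).symm
    have hB : ∀ i (j : Fin (p + 1)), (B ⟨i, j⟩ : V) = (N ^ (j : ℕ)) v := by
      intro i j
      rw [Basis.reindex_apply, Basis.map_apply, LinearEquiv.ofInjective_apply, Pi.basisFun_apply]
      exact hΨ1 j
    refine ⟨Unit, inferInstance, fun _ => p + 1, fun _ => 0, B, fun _ => p.succ_pos,
      fun _ => rfl, ?_, ?_⟩
    · intro i j hj
      refine Subtype.ext ?_
      rw [LinearMap.coe_restrict_apply, zero_smul, zero_add, hB, hB, ← Module.End.mul_apply,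
        ← pow_succ']
    · intro i j hj
      refine Subtype.ext ?_
      rw [LinearMap.coe_restrict_apply, zero_smul, hB, ← Module.End.mul_apply, ← pow_succ',
        pow_apply_eq_zero_of_le hN hj.ge, Submodule.coe_zero]

end

theorem restrict_pow_apply_coe {D V : Type*} [DivisionRing D] [AddCommGroup V] [Module D V]
    {f : V →ₗ[D] V} {W : Submodule D V} (hW : ∀ x ∈ W, f x ∈ W) (k : ℕ) (x : W) :
    (((f.restrict hW) ^ k) x : V) = (f ^ k) x := by
  induction k with
  | zero => rfl
  | succ k ih => rw [pow_succ', Module.End.mul_apply, LinearMap.coe_restrict_apply, ih, pow_succ',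
      Module.End.mul_apply]

universe u in
/-- A nilpotent endomorphism of a finite-dimensional space over a division ring has a Jordan basis. -/
theorem IsNilpotent.hasJordanBasis {D : Type*} [DivisionRing D] {V : Type u} [AddCommGroup V]
    [Module D V] [Module.Finite D V] {N : V →ₗ[D] V} (hN : ∃ k, N ^ k = 0) :
    HasJordanBasis N {0} := by
  induction hn : finrank D V using Nat.strong_induction_on generalizing V with
  | _ n ih =>
    rcases subsingleton_or_nontrivial V with _ | _
    · exact .of_subsingleton _ _
    · classical
      obtain ⟨p, hp⟩ : ∃ p, Nat.find hN = p + 1 := by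
        refine Nat.exists_eq_succ_of_ne_zero fun h => ?_
        have := Nat.find_spec hN
        rw [h, pow_zero] at this
        exact one_ne_zero this
      have h1 := Nat.find_spec hN
      have h2 : N ^ p ≠ 0 := Nat.find_min hN (by omega)
      rw [hp] at h1
      obtain ⟨U, W, hU, hUW, hW, hU0, hJ⟩ := exists_isCompl_chain h1 h2
      refine .of_isCompl hUW hU hW hJ (ih (finrank D W) ?_ ⟨p + 1, ?_⟩ rfl)
      · rw [← hn]
        refine Submodule.finrank_lt fun h => hU0 ?_
        have := hUW.disjoint
        rwa [h, disjoint_top] at this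
      · refine LinearMap.ext fun x => Subtype.ext ?_
        rw [restrict_pow_apply_coe, h1]
        rfl

/-! ### Jordan form of quaternion matrices -/

namespace QTensor

theorem unitJ_mul_unitJ : unitJ * unitJ = -1 := by
  ext <;> simp [Quaternion.re_mul, Quaternion.imI_mul, Quaternion.imJ_mul, Quaternion.imK_mul] <;>
    simp [unitJ]

theorem coeComplex_mul_unitJ (z : ℂ) :
    (z : ℍ[ℝ]) * unitJ = unitJ * ((starRingEnd ℂ z : ℂ) : ℍ[ℝ]) := by
  ext <;> simp [Quaternion.re_mul, Quaternion.imI_mul, Quaternion.imJ_mul, Quaternion.imK_mul] <;>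
    simp [unitJ]

section

variable {V : Type*} [AddCommGroup V] [Module ℍ[ℝ] V]

theorem unitJ_smul_unitJ_smul (v : V) : unitJ • unitJ • v = -v := by
  rw [smul_smul, unitJ_mul_unitJ, neg_smul, one_smul]

theorem coeComplex_smul_unitJ_smul (z : ℂ) (v : V) :
    (z : ℍ[ℝ]) • unitJ • v = unitJ • ((starRingEnd ℂ z : ℂ) : ℍ[ℝ]) • v := by
  rw [smul_smul, coeComplex_mul_unitJ, smul_smul]

variable [Module ℂ V]

/-- An ℍ-linear map commutes with j, while j conjugates complex scalars. Hence j carries the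
generalized eigenspace of `z` into that of its conjugate. -/
theorem pow_sub_smul_apply_unitJ_smul (hc : ∀ (z : ℂ) (v : V), z • v = (z : ℍ[ℝ]) • v)
    {f : V →ₗ[ℍ[ℝ]] V} {fc : V →ₗ[ℂ] V} (hf : ∀ v, fc v = f v) (z : ℂ) (k : ℕ) (v : V) :
    ((fc - starRingEnd ℂ z • 1) ^ k) (unitJ • v) = unitJ • ((fc - z • 1) ^ k) v := by
  induction k generalizing v with
  | zero => rfl
  | succ k ih =>
    rw [pow_succ, Module.End.mul_apply, pow_succ, Module.End.mul_apply, ← ih]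
    congr 1
    simp only [LinearMap.sub_apply, LinearMap.smul_apply, Module.End.one_apply, hf, hc, map_smul,
      smul_sub, coeComplex_smul_unitJ_smul, Complex.conj_conj]

open Polynomial in
-- Powers of `X - z` and `X - w` are coprime, so the kernel of their product, here everything, is a
-- direct sum.
theorem isCompl_ker_pow_sub_smul {E : Type*} [AddCommGroup E] [Module ℂ E] {f : E →ₗ[ℂ] E}
    {z w : ℂ} (hzw : z ≠ w) {k : ℕ} (hk : ((f - z • 1) * (f - w • 1)) ^ k = 0) :
    IsCompl (LinearMap.ker ((f - z • 1) ^ k)) (LinearMap.ker ((f - w • 1) ^ k)) := by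
  have ha : ∀ x : ℂ, (f - x • 1) ^ k = aeval f ((X - C x) ^ k) := fun x => by
    simp [Algebra.algebraMap_eq_smul_one]
  have hco : IsCoprime ((X - C z) ^ k) ((X - C w) ^ k) :=
    (isCoprime_X_sub_C_of_isUnit_sub (sub_ne_zero.mpr hzw).isUnit).pow
  rw [ha, ha]
  refine ⟨disjoint_ker_aeval_of_isCoprime f hco, codisjoint_iff.mpr ?_⟩
  rw [sup_ker_aeval_eq_ker_aeval_mul_of_coprime f hco, ← mul_pow, map_pow, map_mul]
  simp only [map_sub, aeval_X, aeval_C, Algebra.algebraMap_eq_smul_one]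
  rw [hk, LinearMap.ker_zero]

/-- The eigenvalues of quaternion Jordan matrices. -/
def upperEigenvalues : Set ℍ[ℝ] := {q | ∃ z : ℂ, 0 ≤ z.im ∧ q = z}

/-- If all complex eigenvalues are `z` and its conjugate, with `z` not real, then a complex Jordan
basis of the generalized eigenspace of `z` is a quaternion Jordan basis of the whole space. -/
theorem hasJordanBasis_of_im_pos [Module.Finite ℂ V]
    (hc : ∀ (z : ℂ) (v : V), z • v = (z : ℍ[ℝ]) • v)
    {f : V →ₗ[ℍ[ℝ]] V} {fc : V →ₗ[ℂ] V} (hf : ∀ v, fc v = f v) {z : ℂ} (hz : 0 < z.im) {k : ℕ}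
    (hk : ((fc - z • 1) * (fc - starRingEnd ℂ z • 1)) ^ k = 0) :
    HasJordanBasis f upperEigenvalues := by
  have hne : z ≠ starRingEnd ℂ z := fun h => by
    have := congrArg Complex.im h
    rw [Complex.conj_im] at this
    linarith
  have hcompl := isCompl_ker_pow_sub_smul hne hk
  set W := LinearMap.ker ((fc - z • 1) ^ k) with hWdef
  set W' := LinearMap.ker ((fc - starRingEnd ℂ z • 1) ^ k) with hW'def
  have hJ : ∀ v ∈ W, unitJ • v ∈ W' := fun v hv => by
    rw [hWdef, LinearMap.mem_ker] at hv
    rw [hW'def, LinearMap.mem_ker, pow_sub_smul_apply_unitJ_smul hc hf, hv, smul_zero]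
  have hJ' : ∀ v ∈ W', unitJ • v ∈ W := fun v hv => by
    rw [hW'def, LinearMap.mem_ker] at hv
    have := pow_sub_smul_apply_unitJ_smul hc hf (starRingEnd ℂ z) k v
    rw [Complex.conj_conj, hv, smul_zero] at this
    exact this
  have hTW : ∀ x ∈ W, (fc - z • 1) x ∈ W := fun x hx => by
    rw [hWdef, LinearMap.mem_ker] at hx ⊢
    rw [← Module.End.mul_apply, ← pow_succ, pow_succ', Module.End.mul_apply, hx, map_zero]
  obtain ⟨ι, _, d, y, b, hd, hy, hb, hb0⟩ :=
    IsNilpotent.hasJordanBasis (N := (fc - z • 1).restrict hTW) ⟨k, by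
      refine LinearMap.ext fun x => Subtype.ext ?_
      rw [restrict_pow_apply_coe]
      exact x.2⟩
  have hli : LinearIndependent ℍ[ℝ] fun i => (b i : V) := by
    rw [Fintype.linearIndependent_iff]
    intro q hq
    -- Splitting each coefficient as c₁ + j c₂ writes the relation as a vector of `W` plus a vector
    -- of `W'`. Both vanish, and each gives a complex relation among the `b i`.
    have hsplit : (∑ i, dPart (q i) • (b i : V)) + unitJ • ∑ i, cPart (q i) • (b i : V) = 0 := by
      rw [← hq, Finset.smul_sum, ← Finset.sum_add_distrib]
      refine Finset.sum_congr rfl fun i _ => ?_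
      rw [hc, hc, smul_smul, ← add_smul, dPart_add_unitJ_mul_cPart]
    have h1 : ∀ c : (Σ i, Fin (d i)) → ℂ, ∑ i, c i • (b i : V) ∈ W := fun c =>
      Submodule.sum_mem _ fun i _ => Submodule.smul_mem _ _ (b i).2
    have h2 : ∀ c : (Σ i, Fin (d i)) → ℂ, ∑ i, c i • (b i : V) = 0 → ∀ i, c i = 0 := by
      intro c hc0
      refine Fintype.linearIndependent_iff.mp b.linearIndependent c (Subtype.ext ?_)
      simpa using hc0
    have h3 : ∑ i, dPart (q i) • (b i : V) = 0 := by
      refine Submodule.disjoint_def.mp hcompl.disjoint _ (h1 _) ?_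
      rw [eq_neg_of_add_eq_zero_left hsplit]
      exact Submodule.neg_mem _ (hJ _ (h1 _))
    have h4 : ∑ i, cPart (q i) • (b i : V) = 0 := by
      rw [h3, zero_add] at hsplit
      have := congrArg (unitJ • ·) hsplit
      simpa only [unitJ_smul_unitJ_smul, smul_zero, neg_eq_zero] using this
    intro i
    rw [← dPart_add_unitJ_mul_cPart (q i), h2 _ h3 i, h2 _ h4 i]
    simp
  have hspanW : ∀ w ∈ W, w ∈ Submodule.span ℍ[ℝ] (Set.range fun i => (b i : V)) := by
    intro w hw
    have := congrArg Subtype.val (b.sum_repr ⟨w, hw⟩)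
    rw [← show _ = w from this, AddSubmonoidClass.coe_finsetSum]
    refine Submodule.sum_mem _ fun i _ => ?_
    rw [Submodule.coe_smul, hc]
    exact Submodule.smul_mem _ _ (Submodule.subset_span ⟨i, rfl⟩)
  have hspan : ⊤ ≤ Submodule.span ℍ[ℝ] (Set.range fun i => (b i : V)) := by
    intro v _
    obtain ⟨w, hw, w', hw', rfl⟩ := Submodule.mem_sup.mp
      (show v ∈ W ⊔ W' by rw [hcompl.sup_eq_top]; trivial)
    refine Submodule.add_mem _ (hspanW w hw) ?_
    rw [← neg_neg w', ← unitJ_smul_unitJ_smul w']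
    exact Submodule.neg_mem _ (Submodule.smul_mem _ _ (hspanW _ (hJ' _ hw')))
  have hfT : ∀ x : W, f x = (z : ℍ[ℝ]) • (x : V) + ((fc - z • 1).restrict hTW x : V) := by
    intro x
    rw [LinearMap.coe_restrict_apply, LinearMap.sub_apply, LinearMap.smul_apply,
      Module.End.one_apply, hf, ← hc]
    abel
  refine ⟨ι, inferInstance, d, fun _ => (z : ℍ[ℝ]), Basis.mk hli hspan, hd,
    fun _ => ⟨z, hz.le, rfl⟩, ?_, ?_⟩
  · intro i j hj
    rw [Basis.mk_apply, Basis.mk_apply, hfT, hb i j hj, show y i = 0 from hy i, zero_smul, zero_add]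
  · intro i j hj
    rw [Basis.mk_apply, hfT, hb0 i j hj, show y i = 0 from hy i, zero_smul, Submodule.coe_zero,
      add_zero]

end

section

variable {V : Type*} [AddCommGroup V] [Module ℍ[ℝ] V] [Module ℝ V] [IsScalarTower ℝ ℍ[ℝ] V]

theorem coe_real_smul (r : ℝ) (v : V) : (((r : ℂ) : ℍ[ℝ])) • v = r • v := by
  rw [Quaternion.coeComplex_coe, ← algebraMap_smul ℍ[ℝ] r v]
  rfl

/-- A real scalar is central, so adding it to a nilpotent map shifts the eigenvalue in every chain
and keeps the same basis. -/
theorem hasJordanBasis_of_real [Module.Finite ℍ[ℝ] V] {f N : V →ₗ[ℍ[ℝ]] V} {r : ℝ}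
    (hN : ∀ v, f v = r • v + N v) (hk : ∃ k, N ^ k = 0) : HasJordanBasis f upperEigenvalues := by
  obtain ⟨ι, _, d, y, b, hd, hy, hb, hb0⟩ := IsNilpotent.hasJordanBasis hk
  refine ⟨ι, inferInstance, d, fun _ => ((r : ℂ) : ℍ[ℝ]), b, hd, fun _ => ⟨r, by simp, rfl⟩, ?_, ?_⟩
  · intro i j hj
    rw [hN, hb i j hj, show y i = 0 from hy i, zero_smul, zero_add, coe_real_smul]
  · intro i j hj
    rw [hN, hb0 i j hj, show y i = 0 from hy i, zero_smul, add_zero, coe_real_smul]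

end

universe u in
/-- Every endomorphism of a finite-dimensional quaternion vector space has a Jordan basis. -/
theorem hasJordanBasis {V : Type u} [AddCommGroup V] [Module ℍ[ℝ] V] [Module ℝ V]
    [IsScalarTower ℝ ℍ[ℝ] V] [Module.Finite ℍ[ℝ] V] (f : V →ₗ[ℍ[ℝ]] V) :
    HasJordanBasis f upperEigenvalues := by
  induction hn : finrank ℍ[ℝ] V using Nat.strong_induction_on generalizing V with
  | _ n ih =>
    rcases subsingleton_or_nontrivial V with _ | _
    · exact .of_subsingleton _ _
    let _ : Module ℂ V := Module.compHom V Quaternion.ofComplex.toRingHom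
    have hc : ∀ (z : ℂ) (v : V), z • v = (z : ℍ[ℝ]) • v := fun _ _ => rfl
    have hr : ∀ (r : ℝ) (v : V), (r : ℂ) • v = r • v := fun r v => coe_real_smul r v
    have : IsScalarTower ℝ ℂ V := ⟨fun r z v => by
      rw [← hr, smul_smul, Complex.real_smul]⟩
    have : SMulCommClass ℍ[ℝ] ℝ V := IsScalarTower.to_smulCommClass'
    have : Module.Finite ℝ V := Module.Finite.trans ℍ[ℝ] V
    have : Module.Finite ℂ V := Module.Finite.of_restrictScalars_finite ℝ ℂ V
    let fc : V →ₗ[ℂ] V := { f with map_smul' := fun z v => f.map_smul (z : ℍ[ℝ]) v }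
    have hf : ∀ v, fc v = f v := fun _ => rfl
    obtain ⟨z, v, hz, hv0, hv⟩ : ∃ (z : ℂ) (v : V), 0 ≤ z.im ∧ v ≠ 0 ∧ f v = (z : ℍ[ℝ]) • v := by
      obtain ⟨z, hz⟩ := Module.End.exists_eigenvalue fc
      obtain ⟨v, hv⟩ := hz.exists_hasEigenvector
      have hfv : f v = (z : ℍ[ℝ]) • v := hv.apply_eq_smul
      rcases le_total 0 z.im with h | h
      · exact ⟨z, v, h, hv.2, hfv⟩
      -- Multiplication by j reflects the eigenvalue into the upper half plane.
      · refine ⟨starRingEnd ℂ z, unitJ • v, by simpa using h, fun h0 => hv.2 ?_, ?_⟩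
        · have := unitJ_smul_unitJ_smul v
          rwa [h0, smul_zero, eq_comm, neg_eq_zero] at this
        · rw [map_smul, hfv, coeComplex_smul_unitJ_smul, Complex.conj_conj]
    -- Over ℂ this is (f - z)(f - z̄). Its coefficients are real, so it is ℍ-linear and commutes
    -- with `f`, whereas f - z is in general not ℍ-linear.
    let g : V →ₗ[ℍ[ℝ]] V := f * f - (2 * z.re) • f + Complex.normSq z • 1
    have hg : ∀ w, g w = f (f w) - (2 * z.re) • f w + Complex.normSq z • w := fun _ => rfl
    have hgc : ∀ w, g w = ((fc - z • 1) * (fc - starRingEnd ℂ z • 1)) w := by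
      intro w
      simp only [Module.End.mul_apply, LinearMap.sub_apply, LinearMap.smul_apply,
        Module.End.one_apply, map_sub, map_smul, smul_sub, smul_smul]
      rw [hg, ← hr, ← hr, hf, hf, ← Complex.add_conj, add_smul, ← Complex.mul_conj,
        mul_comm z (starRingEnd ℂ z)]
      abel
    have hfg : Commute f g := by
      refine LinearMap.ext fun w => ?_
      rw [Module.End.mul_apply, Module.End.mul_apply, hg, hg, map_add, map_sub]
      simp only [LinearMap.map_smul_of_tower]
    have hgv : g v = 0 := by
      have hfv : fc v = z • v := hv
      rw [hgc, Module.End.mul_apply]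
      simp only [LinearMap.sub_apply, LinearMap.smul_apply, Module.End.one_apply, hfv, map_sub,
        map_smul, smul_sub, smul_smul]
      abel
    -- Fitting decomposition. The bound `1 ≤ k` puts the eigenvector `v` in the kernel, so the range
    -- is a proper subspace and the induction applies to it.
    obtain ⟨k, hk1, hk⟩ : ∃ k, 1 ≤ k ∧
        IsCompl (LinearMap.ker (g ^ k)) (LinearMap.range (g ^ k)) :=
      ((Filter.eventually_ge_atTop 1).and g.eventually_isCompl_ker_pow_range_pow).exists
    by_cases h0 : g ^ k = 0
    · rcases hz.eq_or_lt with hz | hz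
      · let N : V →ₗ[ℍ[ℝ]] V := f - z.re • 1
        have hNv : ∀ w, N w = f w - z.re • w := fun _ => rfl
        have hN : N ^ 2 = g := by
          refine LinearMap.ext fun w => ?_
          rw [sq, Module.End.mul_apply, hNv, hNv, map_sub, LinearMap.map_smul_of_tower, hg,
            Complex.normSq_apply, ← hz]
          module
        refine hasJordanBasis_of_real (r := z.re) (N := N) (fun w => ?_) ⟨2 * k, ?_⟩
        · rw [hNv]
          abel
        · rw [pow_mul, hN, h0]
      · refine hasJordanBasis_of_im_pos hc hf hz (k := k) (LinearMap.ext fun w => ?_)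
        have : ∀ (m : ℕ) (w : V), (((fc - z • 1) * (fc - starRingEnd ℂ z • 1)) ^ m) w =
            (g ^ m) w := by
          intro m
          induction m with
          | zero => exact fun _ => rfl
          | succ m ihm =>
            intro w
            rw [pow_succ, pow_succ, Module.End.mul_apply, ← hgc, ihm, Module.End.mul_apply]
        rw [this, h0]
        rfl
    · have hcom : ∀ w, f ((g ^ k) w) = (g ^ k) (f w) := fun w =>
        LinearMap.congr_fun (hfg.pow_right k) w
      have hK : ∀ x ∈ LinearMap.ker (g ^ k), f x ∈ LinearMap.ker (g ^ k) := fun x hx => by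
        rw [LinearMap.mem_ker] at hx ⊢
        rw [← hcom, hx, map_zero]
      have hR : ∀ x ∈ LinearMap.range (g ^ k), f x ∈ LinearMap.range (g ^ k) := by
        rintro _ ⟨x, rfl⟩
        exact ⟨f x, (hcom x).symm⟩
      refine .of_isCompl hk hK hR (ih _ ?_ _ rfl) (ih _ ?_ _ rfl)
      · rw [← hn]
        refine Submodule.finrank_lt fun h => h0 ?_
        exact LinearMap.ker_eq_top.mp h
      · rw [← hn]
        refine Submodule.finrank_lt fun h => hv0 ?_
        refine Submodule.disjoint_def.mp hk.disjoint v ?_ (h ▸ trivial)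
        rw [LinearMap.mem_ker, ← Nat.sub_add_cancel hk1, pow_succ, Module.End.mul_apply, hgv,
          map_zero]

theorem sum_jordanBlock_smul {E : Type*} [AddCommGroup E] [Module ℍ[ℝ] E] (d : ℕ) (z : ℂ)
    (v : Fin d → E) (j : Fin d) :
    ∑ l, jordanBlock d z j l • v l =
      (z : ℍ[ℝ]) • v j + ∑ l : Fin d, if (l : ℕ) = j + 1 then v l else 0 := by
  rw [← Finset.sum_erase_add _ _ (Finset.mem_univ j),
    ← Finset.sum_erase_add Finset.univ (fun l : Fin d => if (l : ℕ) = j + 1 then v l else 0)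
      (Finset.mem_univ j), if_neg (by omega), add_zero, add_comm]
  congr 1
  · simp [jordanBlock]
  · refine Finset.sum_congr rfl fun l hl => ?_
    have : j ≠ l := (Finset.ne_of_mem_erase hl).symm
    simp [jordanBlock, this]

/-- Every quaternion matrix has a Jordan canonical form. -/
theorem exists_isJordanForm {n : ℕ} (M : Matrix (Fin n) (Fin n) ℍ[ℝ]) :
    ∃ J, IsJordanForm M J := by
  -- Left ℍ-linearity requires the action on row vectors. The basis vectors become the rows of `T`,
  -- and chains running to the next index give upper Jordan blocks in `T * M = J * T`.
  obtain ⟨ι, _, d, y, b, hd, hy, hb, hb0⟩ := hasJordanBasis M.vecMulLinear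
  choose z hz hyz using hy
  let e : Fin (Fintype.card ι) ≃ ι := (Fintype.equivFin ι).symm
  let B₀ : Basis (Σ a, Fin (d (e a))) ℍ[ℝ] (Fin n → ℍ[ℝ]) :=
    b.reindex (Equiv.sigmaCongrLeft (β := fun i => Fin (d i)) e).symm
  have hB₀ : ∀ a (j : Fin (d (e a))), B₀ ⟨a, j⟩ = b ⟨e a, j⟩ := fun a j => by
    rw [Basis.reindex_apply]
    rfl
  have h : ∑ a, d (e a) = n := by
    have := Module.finrank_eq_card_basis B₀
    simpa using this.symm
  let σ := finSigmaFinEquiv.trans (finCongr h)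
  let J₀ := Matrix.blockDiagonal' fun a => jordanBlock (d (e a)) (z (e a))
  have hJ₀ : ∀ a j l, J₀ ⟨a, j⟩ ⟨a, l⟩ = jordanBlock (d (e a)) (z (e a)) j l :=
    fun a j l => Matrix.blockDiagonal'_apply_eq _ _ _ _
  have hJ₀' : ∀ a a' j l, a ≠ a' → J₀ ⟨a, j⟩ ⟨a', l⟩ = 0 :=
    fun a a' j l h => Matrix.blockDiagonal'_apply_ne _ _ _ h
  let B := B₀.reindex σ
  have hB : ∀ x, B (σ x) = B₀ x := fun x => by rw [Basis.reindex_apply, Equiv.symm_apply_apply]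
  let T : Matrix (Fin n) (Fin n) ℍ[ℝ] := Matrix.of fun k => B k
  let S : Matrix (Fin n) (Fin n) ℍ[ℝ] := Matrix.of fun i k => B.repr (Pi.single i 1) k
  have hST : S * T = 1 := by
    refine Matrix.ext fun i l => ?_
    have := congrFun (B.sum_repr (Pi.single i 1)) l
    rw [Finset.sum_apply] at this
    rw [Matrix.mul_apply, Matrix.one_eq_pi_single]
    exact this
  have hTS : T * S = 1 := by
    refine Matrix.ext fun k l => ?_
    have h1 : ∑ i, T k i • (Pi.single i 1 : Fin n → ℍ[ℝ]) = B k := by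
      rw [← pi_eq_sum_univ']
      rfl
    have h2 := congrArg (fun v => B.repr v l) h1
    simp only [map_sum, map_smul, Finsupp.coe_finsetSum, Finset.sum_apply, Finsupp.smul_apply,
      Basis.repr_self] at h2
    rw [Matrix.mul_apply, Matrix.one_apply]
    rw [Finsupp.single_apply] at h2
    exact h2
  have hTM : T * M = Matrix.reindex σ σ J₀ * T := by
    refine funext fun k => ?_
    obtain ⟨⟨a, j⟩, rfl⟩ := σ.surjective k
    have hL : (T * M) (σ ⟨a, j⟩) = M.vecMulLinear (b ⟨e a, j⟩) := by
      rw [← hB₀, ← hB]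
      rfl
    have hR : (Matrix.reindex σ σ J₀ * T) (σ ⟨a, j⟩) =
        ∑ l, jordanBlock (d (e a)) (z (e a)) j l • b ⟨e a, l⟩ := by
      have h1 : (Matrix.reindex σ σ J₀ * T) (σ ⟨a, j⟩) = ∑ x, J₀ ⟨a, j⟩ x • B₀ x := by
        funext m
        rw [Matrix.mul_apply, ← σ.sum_comp, Finset.sum_apply]
        refine Finset.sum_congr rfl fun x _ => ?_
        rw [Matrix.reindex_apply, Matrix.submatrix_apply, Equiv.symm_apply_apply,
          Equiv.symm_apply_apply, Pi.smul_apply, smul_eq_mul, ← hB]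
        rfl
      rw [h1, Fintype.sum_sigma, Finset.sum_eq_single a]
      · refine Finset.sum_congr rfl fun l _ => ?_
        rw [hJ₀, hB₀]
      · intro a' _ ha'
        refine Finset.sum_eq_zero fun l _ => ?_
        rw [hJ₀' _ _ _ _ ha'.symm, zero_smul]
      · simp
    rw [hL, hR, sum_jordanBlock_smul, ← hyz]
    by_cases hj : (j : ℕ) + 1 < d (e a)
    · rw [hb _ _ hj, Finset.sum_eq_single ⟨(j : ℕ) + 1, hj⟩, if_pos rfl]
      · exact fun l _ hl => if_neg fun h => hl (Fin.ext h)
      · simp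
    · rw [hb0 _ _ (by omega), Finset.sum_eq_zero, add_zero]
      exact fun l _ => if_neg (by omega)
  refine ⟨Matrix.reindex σ σ J₀, ⟨Fintype.card ι, fun a => d (e a), fun a => z (e a), h,
    fun a => hd _, fun a => hz _, rfl⟩, S, T, hST, hTS, ?_⟩
  rw [Matrix.mul_assoc, ← hTM, ← Matrix.mul_assoc, hST, Matrix.one_mul]

end QTensor

/-! ### Drazin inverses in monoids and finite-dimensional algebras -/

/-- `x` is a Drazin inverse of the ring element `a`, with respect to the exponent `k`. -/
structure IsDrazinInverse {R : Type*} [Monoid R] (a x : R) (k : ℕ) : Prop where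
  pow_mul_mul : a ^ k * x * a = a ^ k
  mul_mul : x * a * x = x
  comm : a * x = x * a

namespace IsDrazinInverse

section

variable {R : Type*} [Monoid R] {a x y : R} {k l : ℕ}

theorem mono (h : IsDrazinInverse a x k) (hkl : k ≤ l) : IsDrazinInverse a x l := by
  refine ⟨?_, h.mul_mul, h.comm⟩
  rw [← Nat.sub_add_cancel hkl, pow_add, mul_assoc, mul_assoc, ← mul_assoc (a ^ k), h.pow_mul_mul]

theorem mul_pow_succ (h : IsDrazinInverse a x k) (m : ℕ) : (x * a) ^ (m + 1) = x * a := by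
  induction m with
  | zero => rw [zero_add, pow_one]
  | succ m ih => rw [pow_succ, ih, ← mul_assoc, h.mul_mul]

/-- The idempotent `x * a` equals `x ^ (k + 1) * a ^ (k + 1)`, and its factor `a ^ k` absorbs `y *
a`. -/
theorem mul_mul_mul (hx : IsDrazinInverse a x k) (hy : IsDrazinInverse a y k) :
    (x * a) * (y * a) = x * a := by
  have hcx : Commute a x := hx.comm
  have h1 : x * a = x ^ (k + 1) * a * a ^ k := by
    rw [mul_assoc, ← pow_succ', ← hcx.symm.mul_pow, hx.mul_pow_succ]
  rw [h1, mul_assoc, ← mul_assoc (a ^ k), hy.pow_mul_mul]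

theorem mul_mul_mul' (hx : IsDrazinInverse a x k) (hy : IsDrazinInverse a y k) :
    (y * a) * (x * a) = x * a := by
  have hcx : Commute a x := hx.comm
  have hcy : Commute a y := hy.comm
  have h1 : x * a = a ^ k * (a * x ^ (k + 1)) := by
    rw [← mul_assoc, ← pow_succ, ← hcx.mul_pow, hcx.eq, hx.mul_pow_succ]
  have h2 : y * a * a ^ k = a ^ k := by
    rw [((hcy.pow_left k).symm.mul_left (Commute.self_pow a k)).eq, ← mul_assoc, hy.pow_mul_mul]
  rw [h1, ← mul_assoc, h2]

/-- Each of the idempotents `x * a` and `y * a` equals their product, so they coincide; then `x = x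
* a * x` and `y = y * a * y` agree. The exponents may differ, since both can be raised to their
maximum. -/
theorem eq (hx : IsDrazinInverse a x k) (hy : IsDrazinInverse a y l) : x = y := by
  replace hx := hx.mono (le_max_left k l)
  replace hy := hy.mono (le_max_right k l)
  have he : x * a = y * a := (hx.mul_mul_mul' hy).symm.trans (hy.mul_mul_mul hx)
  rw [← hx.mul_mul, he, mul_assoc, hx.comm, he, ← hy.comm, ← mul_assoc, hy.mul_mul]

theorem conj {s t : R} (h : IsDrazinInverse a x k) (hst : s * t = 1) (hts : t * s = 1) :
    IsDrazinInverse (s * a * t) (s * x * t) k := by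
  have hm : ∀ b c, s * b * t * (s * c * t) = s * (b * c) * t := fun b c => by
    rw [show s * b * t * (s * c * t) = s * b * (t * s) * c * t by simp only [mul_assoc], hts]
    simp only [mul_assoc, one_mul]
  have hp : ∀ m, (s * a * t) ^ m = s * a ^ m * t := by
    intro m
    induction m with
    | zero => rw [pow_zero, pow_zero, mul_one, hst]
    | succ m ih => rw [pow_succ, ih, hm, pow_succ]
  exact ⟨by rw [hp, hm, hm, h.pow_mul_mul], by rw [hm, hm, h.mul_mul], by rw [hm, hm, h.comm]⟩

end

/-- The witness is `a ^ k * y ^ (k + 1)`. Iterating the hypothesis gives `a ^ k = a ^ k * (a ^ i * y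
^ i)` for all `i`, from which the axioms follow by commutativity. -/
theorem exists_of_pow_eq_pow_succ_mul {R : Type*} [Monoid R] {a y : R} {k : ℕ}
    (hc : Commute a y) (h : a ^ k = a ^ (k + 1) * y) : ∃ x, IsDrazinInverse a x k := by
  have hi : ∀ i, a ^ k = a ^ k * (a ^ i * y ^ i) := by
    intro i
    induction i with
    | zero => simp
    | succ i ih =>
      have h' : a ^ k = a ^ k * (a * y) := by rw [← mul_assoc, ← pow_succ, ← h]
      rw [← hc.mul_pow, pow_succ', ← mul_assoc, ← h', hc.mul_pow, ← ih]
  have hcp : ∀ m, Commute a (y ^ m) := fun m => hc.pow_right m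
  have key : a ^ k * y ^ (k + 1) * a * a ^ k = a ^ k := by
    rw [mul_assoc, ← pow_succ', mul_assoc, ((hcp (k + 1)).pow_left (k + 1)).eq.symm, ← hi]
  have hx : Commute a (a ^ k * y ^ (k + 1)) := (Commute.self_pow a k).mul_right (hcp _)
  refine ⟨a ^ k * y ^ (k + 1), ?_, ?_, hx⟩
  · rw [mul_assoc, (hx.symm.mul_left (Commute.refl a)).pow_right k |>.eq.symm, key]
  · rw [← mul_assoc, key]

end IsDrazinInverse

open Polynomial in
/-- In a finite-dimensional algebra, a one-sided stability condition on the powers of `a` is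
witnessed by an element that commutes with `a`. -/
theorem exists_commute_pow_eq_pow_succ_mul (F : Type*) {R : Type*} [Field F] [Ring R] [Algebra F R]
    [Module.Finite F R] {a y : R} {k : ℕ} (h : a ^ k = a ^ (k + 1) * y) :
    ∃ y', Commute a y' ∧ a ^ k = a ^ (k + 1) * y' := by
  -- The minimal polynomial is `X ^ j * q` with `q` nonzero at `0`. As `a ^ k` is a left multiple by
  -- `a ^ j`, it is killed by `q(a)`; dividing by the constant term of `q` expresses it through `a ^
  -- (k + 1)`.
  obtain ⟨q, hpq, hq⟩ := exists_eq_pow_rootMultiplicity_mul_and_not_dvd (minpoly F a)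
    (minpoly.ne_zero (Algebra.IsIntegral.isIntegral a)) 0
  set j := rootMultiplicity 0 (minpoly F a)
  have hi : ∀ i, a ^ k = a ^ i * (a ^ k * y ^ i) := by
    intro i
    induction i with
    | zero => simp
    | succ i ih =>
      rw [pow_succ, mul_assoc, pow_succ', ← mul_assoc (a ^ k), ← mul_assoc a, ← mul_assoc a,
        ← pow_succ', ← h, ← ih]
  have hqa : aeval a q * a ^ j = 0 := by
    have := minpoly.aeval F a
    rw [hpq, C_0, sub_zero, mul_comm, map_mul, map_pow, aeval_X] at this
    exact this
  have hc : ∀ p : F[X], Commute a (aeval a p) := fun p => by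
    have := (Commute.all (X : F[X]) p).map (aeval a)
    rwa [aeval_X] at this
  have hqk : a ^ k * aeval a q = 0 := by
    rw [((hc q).pow_left k).eq, hi j, ← mul_assoc, hqa, zero_mul]
  have hq0 : q.coeff 0 ≠ 0 := fun h0 => hq (by rwa [C_0, sub_zero, X_dvd_iff])
  refine ⟨-((q.coeff 0)⁻¹ • aeval a q.divX), ((hc _).smul_right _).neg_right, ?_⟩
  rw [← divX_mul_X_add q, map_add, map_mul, aeval_X, aeval_C, Algebra.algebraMap_eq_smul_one,
    mul_add, mul_smul_comm, mul_one, ← (hc q.divX).eq, ← mul_assoc, ← pow_succ] at hqk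
  have : q.coeff 0 • a ^ k = -(a ^ (k + 1) * aeval a q.divX) := eq_neg_of_add_eq_zero_right hqk
  rw [mul_neg, mul_smul_comm, ← smul_neg, ← this, smul_smul, inv_mul_cancel₀ hq0, one_smul]

/-! ### The Fourier transform and the QT-product -/

namespace QTensor

variable {n₁ r n₂ n n₃ : ℕ}

/-- The entry `ω^{st}` of the Fourier matrix. -/
noncomputable def fourierEntry (n₃ : ℕ) (s t : Fin n₃) : ℂ :=
  Complex.exp (-(2 * Real.pi * Complex.I) / n₃) ^ ((s : ℕ) * (t : ℕ))

theorem isPrimitiveRoot_exp_neg [NeZero n₃] :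
    IsPrimitiveRoot (Complex.exp (-(2 * Real.pi * Complex.I) / n₃)) n₃ := by
  rw [neg_div, Complex.exp_neg]
  exact (Complex.isPrimitiveRoot_exp n₃ (NeZero.ne n₃)).inv

theorem conj_exp_neg : starRingEnd ℂ (Complex.exp (-(2 * Real.pi * Complex.I) / n₃)) =
    (Complex.exp (-(2 * Real.pi * Complex.I) / n₃))⁻¹ := by
  rw [← Complex.exp_conj, ← Complex.exp_neg]
  simp [neg_div, map_ofNat]

theorem fourierEntry_comm (s t : Fin n₃) : fourierEntry n₃ s t = fourierEntry n₃ t s := by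
  rw [fourierEntry, fourierEntry, mul_comm (s : ℕ)]

theorem conj_mul_fourierEntry (s t : Fin n₃) :
    starRingEnd ℂ (fourierEntry n₃ s t) * fourierEntry n₃ s t = 1 := by
  rw [fourierEntry, map_pow, conj_exp_neg, ← mul_pow, inv_mul_cancel₀ (Complex.exp_ne_zero _),
    one_pow]

theorem dft_apply (A : QTensor n₁ n₂ n₃) (s : Fin n₃) (i : Fin n₁) (j : Fin n₂) :
    dft A s i j = ∑ t, (fourierEntry n₃ s t : ℍ[ℝ]) * A t i j := by
  simp [dft, Matrix.sum_apply, fourierEntry]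

variable [NeZero n₃]

theorem fourierEntry_add (s t u : Fin n₃) :
    fourierEntry n₃ s (t + u) = fourierEntry n₃ s t * fourierEntry n₃ s u := by
  rw [fourierEntry, fourierEntry, fourierEntry, ← pow_add, ← mul_add, Fin.val_add,
    mul_comm (s : ℕ), mul_comm (s : ℕ), pow_mul, pow_mul]
  congr 1
  exact (pow_eq_pow_mod _ isPrimitiveRoot_exp_neg.pow_eq_one).symm

theorem fourierEntry_zero (s : Fin n₃) : fourierEntry n₃ s 0 = 1 := by
  simp [fourierEntry]

theorem fourierEntry_sub (s t u : Fin n₃) :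
    fourierEntry n₃ s (t - u) = fourierEntry n₃ s t * starRingEnd ℂ (fourierEntry n₃ s u) := by
  have h := fourierEntry_add s (t - u) u
  rw [sub_add_cancel] at h
  rw [h, mul_assoc, mul_comm (fourierEntry n₃ s u), conj_mul_fourierEntry, mul_one]

theorem sum_conj_mul_fourierEntry (t u : Fin n₃) :
    ∑ s, starRingEnd ℂ (fourierEntry n₃ s t) * fourierEntry n₃ s u = if t = u then (n₃ : ℂ) else 0 := by
  split_ifs with h
  · subst h
    simp [conj_mul_fourierEntry]
  · have hζ := isPrimitiveRoot_exp_neg (n₃ := n₃)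
    set ζ := Complex.exp (-(2 * Real.pi * Complex.I) / n₃) with hζd
    have hζ0 : ζ ≠ 0 := Complex.exp_ne_zero _
    have hw : ∀ s : Fin n₃, starRingEnd ℂ (fourierEntry n₃ s t) * fourierEntry n₃ s u =
        ((ζ ^ (t : ℕ))⁻¹ * ζ ^ (u : ℕ)) ^ (s : ℕ) := fun s => by
      rw [fourierEntry, fourierEntry, map_pow, conj_exp_neg, ← hζd, mul_pow, inv_pow, inv_pow,
        ← pow_mul, ← pow_mul, mul_comm (s : ℕ), mul_comm (s : ℕ)]
    simp_rw [hw]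
    set w := (ζ ^ (t : ℕ))⁻¹ * ζ ^ (u : ℕ) with hwd
    have hw1 : w - 1 ≠ 0 := by
      refine fun h0 => h (Fin.ext (hζ.pow_inj t.2 u.2 ?_))
      rw [sub_eq_zero, hwd, inv_mul_eq_one₀ (pow_ne_zero _ hζ0)] at h0
      exact h0
    have hwn : w ^ n₃ = 1 := by
      rw [hwd, mul_pow, inv_pow, ← pow_mul, ← pow_mul, mul_comm (u : ℕ), mul_comm (t : ℕ), pow_mul,
        pow_mul, hζ.pow_eq_one, one_pow, one_pow, inv_one, one_mul]
    rw [Fin.sum_univ_eq_sum_range (fun i => w ^ i)]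
    refine (mul_eq_zero.mp ?_).resolve_left hw1
    rw [mul_geom_sum, hwn, sub_self]

/-- The inverse of the discrete Fourier transform. -/
noncomputable def idft (A : QTensor n₁ n₂ n₃) : QTensor n₁ n₂ n₃ := fun t => Matrix.of fun i j =>
  ∑ s, (((n₃ : ℂ)⁻¹ * starRingEnd ℂ (fourierEntry n₃ s t) : ℂ) : ℍ[ℝ]) * A s i j

theorem coeComplex_sum {ι : Type*} (s : Finset ι) (f : ι → ℂ) :
    ((∑ i ∈ s, f i : ℂ) : ℍ[ℝ]) = ∑ i ∈ s, (f i : ℍ[ℝ]) :=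
  map_sum Quaternion.ofComplex f s

theorem idft_dft (A : QTensor n₁ n₂ n₃) : idft (dft A) = A := by
  funext t
  ext1 i j
  simp only [idft, Matrix.of_apply, dft_apply, Finset.mul_sum]
  rw [Finset.sum_comm]
  have h : ∀ u, ∑ s, (((n₃ : ℂ)⁻¹ * starRingEnd ℂ (fourierEntry n₃ s t) : ℂ) : ℍ[ℝ]) *
      ((fourierEntry n₃ s u : ℍ[ℝ]) * A u i j) = if t = u then A u i j else 0 := fun u => by
    simp_rw [← mul_assoc, ← Quaternion.coeComplex_mul, ← Finset.sum_mul, ← coeComplex_sum,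
      mul_assoc, ← Finset.mul_sum, sum_conj_mul_fourierEntry]
    split_ifs
    · rw [inv_mul_cancel₀ (NeZero.ne _), Quaternion.coeComplex_one, one_mul]
    · rw [mul_zero, Quaternion.coeComplex_zero, zero_mul]
  rw [Finset.sum_congr rfl fun u _ => h u]
  simp

theorem dft_idft (A : QTensor n₁ n₂ n₃) : dft (idft A) = A := by
  funext t
  ext1 i j
  simp only [idft, Matrix.of_apply, dft_apply, Finset.mul_sum]
  rw [Finset.sum_comm]
  have h : ∀ u, ∑ s, (fourierEntry n₃ t s : ℍ[ℝ]) *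
      ((((n₃ : ℂ)⁻¹ * starRingEnd ℂ (fourierEntry n₃ u s) : ℂ) : ℍ[ℝ]) * A u i j) =
        if u = t then A u i j else 0 := fun u => by
    simp_rw [← mul_assoc, ← Quaternion.coeComplex_mul, ← Finset.sum_mul, ← coeComplex_sum,
      mul_left_comm _ (n₃ : ℂ)⁻¹, ← Finset.mul_sum, mul_comm (fourierEntry n₃ t _),
      fourierEntry_comm t, fourierEntry_comm u, sum_conj_mul_fourierEntry]
    split_ifs
    · rw [inv_mul_cancel₀ (NeZero.ne _), Quaternion.coeComplex_one, one_mul]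
    · rw [mul_zero, Quaternion.coeComplex_zero, zero_mul]
  rw [Finset.sum_congr rfl fun u _ => h u]
  simp

theorem dft_injective : Function.Injective (dft : QTensor n₁ n₂ n₃ → QTensor n₁ n₂ n₃) :=
  Function.LeftInverse.injective idft_dft

/-- The permutation replaces the block column `q` by `-q`, hence the index `t + q` in the j-part. -/
theorem bcircz_apply (A : QTensor n₁ n₂ n₃) (t q : Fin n₃) (i : Fin n₁) (j : Fin n₂) :
    bcircz A (t, i) (q, j) =
      (dPart (A (t - q) i j) : ℍ[ℝ]) + unitJ * (cPart (A (t + q) i j) : ℍ[ℝ]) := by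
  have h : ∀ x : Fin n₃, x + q = 0 ↔ x = -q := fun x => eq_neg_iff_add_eq_zero.symm
  simp only [bcircz, bcirc, permP, Matrix.add_apply, Matrix.smul_apply, Matrix.of_apply,
    Matrix.mul_apply, Matrix.map_apply, smul_eq_mul, Matrix.kroneckerMap_apply, Matrix.one_apply,
    Fintype.sum_prod_type, h]
  congr 2
  rw [Finset.sum_eq_single (-q), Finset.sum_eq_single j]
  · simp
  · intro l _ hl
    simp [hl]
  · simp
  · intro u _ hu
    simp [hu]
  · simp

/-- The shifts by `q` in opposite directions produce ω^{sq} in the complex part and its conjugate in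
the j-part. Moving the conjugate past j undoes the conjugation, so one common factor appears on the
right. -/
theorem sum_fourierEntry_mul (a : Fin n₃ → ℍ[ℝ]) (s q : Fin n₃) :
    ∑ t, (fourierEntry n₃ s t : ℍ[ℝ]) *
        ((dPart (a (t - q)) : ℍ[ℝ]) + unitJ * (cPart (a (t + q)) : ℍ[ℝ])) =
      (∑ u, (fourierEntry n₃ s u : ℍ[ℝ]) * a u) * (fourierEntry n₃ s q : ℍ[ℝ]) := by
  simp_rw [mul_add, Finset.sum_add_distrib]
  rw [← Equiv.sum_comp (Equiv.addRight q) fun t =>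
      (fourierEntry n₃ s t : ℍ[ℝ]) * (dPart (a (t - q)) : ℍ[ℝ]),
    ← Equiv.sum_comp (Equiv.subRight q) fun t =>
      (fourierEntry n₃ s t : ℍ[ℝ]) * (unitJ * (cPart (a (t + q)) : ℍ[ℝ])),
    ← Finset.sum_add_distrib, Finset.sum_mul]
  refine Finset.sum_congr rfl fun u _ => ?_
  simp only [Equiv.coe_addRight, Equiv.subRight_apply, add_sub_cancel_right, sub_add_cancel,
    fourierEntry_add, fourierEntry_sub]
  conv_rhs => rw [← dPart_add_unitJ_mul_cPart (a u)]
  rw [mul_add, add_mul]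
  congr 1
  · rw [← Quaternion.coeComplex_mul, ← Quaternion.coeComplex_mul, ← Quaternion.coeComplex_mul,
      mul_right_comm]
  · rw [Quaternion.coeComplex_mul, mul_assoc, mul_assoc, mul_assoc,
      ← mul_assoc (((starRingEnd ℂ) (fourierEntry n₃ s q) : ℂ) : ℍ[ℝ]), coeComplex_mul_unitJ,
      Complex.conj_conj, mul_assoc, ← Quaternion.coeComplex_mul, ← Quaternion.coeComplex_mul,
      mul_comm (fourierEntry n₃ s q)]

/-- The discrete Fourier transform turns the QT-product into the slicewise matrix product. -/
theorem dft_qtMul (A : QTensor n₁ r n₃) (B : QTensor r n₂ n₃) (s : Fin n₃) :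
    dft (A *Q B) s = dft A s * dft B s := by
  ext1 i j
  rw [dft_apply, Matrix.mul_apply]
  simp only [qtMul, fold, unfold, Matrix.of_apply, Matrix.mul_apply, Fintype.sum_prod_type,
    bcircz_apply, Finset.mul_sum]
  rw [Finset.sum_comm, Finset.sum_congr rfl fun q _ => Finset.sum_comm, Finset.sum_comm]
  refine Finset.sum_congr rfl fun l _ => ?_
  simp only [← mul_assoc, ← Finset.sum_mul]
  simp_rw [sum_fourierEntry_mul (fun t => A t i l), dft_apply B, mul_assoc, ← Finset.mul_sum,
    dft_apply A]

theorem qtMul_assoc {m : ℕ} (A : QTensor n₁ r n₃) (B : QTensor r n₂ n₃) (C : QTensor n₂ m n₃) :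
    A *Q B *Q C = A *Q (B *Q C) := by
  refine dft_injective (funext fun s => ?_)
  rw [dft_qtMul, dft_qtMul, dft_qtMul, dft_qtMul, Matrix.mul_assoc]

theorem dft_qtOne : dft (qtOne n n₃) = 1 := by
  funext s
  ext1 i j
  rw [dft_apply, Finset.sum_eq_single 0]
  · simp [qtOne, fourierEntry_zero]
  · intro t _ ht
    simp [qtOne, ht]
  · simp

theorem dft_qtPow (A : QTensor n n n₃) (k : ℕ) : dft (qtPow A k) = dft A ^ k := by
  induction k with
  | zero => rw [qtPow, dft_qtOne, pow_zero]
  | succ k ih =>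
    rw [qtPow, pow_succ, ← ih]
    exact funext fun s => dft_qtMul _ _ s

theorem dft_qtMul' (A B : QTensor n n n₃) : dft (A *Q B) = dft A * dft B :=
  funext fun s => dft_qtMul A B s

/-! ### QT-rank and column spaces -/

theorem bcircz_mul_unfold (A : QTensor n₁ r n₃) (B : QTensor r n₂ n₃) :
    bcircz A * unfold B = unfold (A *Q B) :=
  rfl

/-- Every vector is the unfolding of a tensor with one column, so this is associativity of `*Q`
tested on the standard basis vectors. -/
theorem bcircz_qtMul (A : QTensor n₁ r n₃) (B : QTensor r n₂ n₃) :
    bcircz (A *Q B) = bcircz A * bcircz B := by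
  refine Matrix.ext_of_mulVec_single fun x => ?_
  let C : QTensor n₂ 1 n₃ := fold (Matrix.replicateCol (Fin 1) (Pi.single x 1))
  have h : ∀ {m k : ℕ} (M : Matrix (Fin n₃ × Fin m) (Fin n₃ × Fin n₂) ℍ[ℝ]),
      (M.mulVec (Pi.single x 1)) = fun p => (M * unfold C) p 0 := fun M => rfl
  rw [h, h, Matrix.mul_assoc, bcircz_mul_unfold, bcircz_mul_unfold, bcircz_mul_unfold, qtMul_assoc]
  exacts [0, 0]

theorem col_mul_mem_span {ι κ μ : Type*} [Fintype κ] (M : Matrix ι κ ℍ[ℝ]) (N : Matrix κ μ ℍ[ℝ])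
    (x : μ) : (M * N).col x ∈ Submodule.span (ℍ[ℝ])ᵐᵒᵖ (Set.range M.col) := by
  have : (M * N).col x = ∑ y, MulOpposite.op (N y x) • M.col y := by
    funext i
    simp [Matrix.mul_apply, Finset.sum_apply]
  rw [this]
  exact Submodule.sum_mem _ fun y _ => Submodule.smul_mem _ _ (Submodule.subset_span ⟨y, rfl⟩)

theorem span_col_mul_le {ι κ μ : Type*} [Fintype κ] (M : Matrix ι κ ℍ[ℝ]) (N : Matrix κ μ ℍ[ℝ]) :
    Submodule.span (ℍ[ℝ])ᵐᵒᵖ (Set.range (M * N).col) ≤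
      Submodule.span (ℍ[ℝ])ᵐᵒᵖ (Set.range M.col) := by
  rw [Submodule.span_le]
  rintro _ ⟨x, rfl⟩
  exact col_mul_mem_span M N x

theorem quatRank_mul_le {ι κ μ : Type*} [Fintype κ] (M : Matrix ι κ ℍ[ℝ]) (N : Matrix κ μ ℍ[ℝ]) :
    quatRank (M * N) ≤ quatRank M := by
  have : Module.Finite (ℍ[ℝ])ᵐᵒᵖ (Submodule.span (ℍ[ℝ])ᵐᵒᵖ (Set.range M.col)) :=
    FiniteDimensional.span_of_finite _ (Set.finite_range _)
  exact LinearMap.finrank_le_finrank_of_injective (Submodule.inclusion_injective (span_col_mul_le M N))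

/-- At the QT-index the QT-ranks of consecutive powers agree. -/
theorem qtRank_qtPow_qtIndex (A : QTensor n n n₃) :
    qtRank (qtPow A (qtIndex A + 1)) = qtRank (qtPow A (qtIndex A)) := by
  refine Nat.sInf_mem (s := {k : ℕ | qtRank (qtPow A (k + 1)) = qtRank (qtPow A k)}) ?_
  -- The set of stable exponents must be nonempty for its infimum to belong to it. Ranks never
  -- increase along powers, so an exponent of minimal rank is stable.
  refine ⟨Function.argmin fun k => qtRank (qtPow A k), le_antisymm ?_ ?_⟩
  · rw [qtRank, qtRank, qtPow, bcircz_qtMul]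
    exact quatRank_mul_le _ _
  · exact Function.argmin_le (fun k => qtRank (qtPow A k)) _

/-- In block column `0` the indices `t - q` and `t + q` agree, so the two complex parts recombine to
the entry of `A`. -/
theorem unfold_col (A : QTensor n₁ n₂ n₃) (j : Fin n₂) : (unfold A).col j = (bcircz A).col (0, j) := by
  funext ⟨t, i⟩
  simp only [Matrix.col_apply, bcircz_apply, sub_zero, add_zero, dPart_add_unitJ_mul_cPart]
  rfl

/-- If multiplication on the right does not lower the QT-rank, it can be undone. -/
theorem exists_qtMul_qtMul_eq {A : QTensor n₁ r n₃} {B : QTensor r n₂ n₃}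
    (h : qtRank (A *Q B) = qtRank A) : ∃ Y : QTensor n₂ r n₃, A = A *Q B *Q Y := by
  have : Module.Finite (ℍ[ℝ])ᵐᵒᵖ (Submodule.span (ℍ[ℝ])ᵐᵒᵖ (Set.range (bcircz A).col)) :=
    FiniteDimensional.span_of_finite _ (Set.finite_range _)
  -- Inclusion with equal dimension forces equal column spaces; the coefficients expressing the
  -- columns of `unfold A` then form `Y`.
  have hspan : Submodule.span (ℍ[ℝ])ᵐᵒᵖ (Set.range (bcircz (A *Q B)).col) =
      Submodule.span (ℍ[ℝ])ᵐᵒᵖ (Set.range (bcircz A).col) := by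
    refine Submodule.eq_of_le_of_finrank_eq ?_ h
    rw [bcircz_qtMul]
    exact span_col_mul_le _ _
  have hcol : ∀ j, ∃ c : Fin n₃ × Fin n₂ → (ℍ[ℝ])ᵐᵒᵖ,
      ∑ x, c x • (bcircz (A *Q B)).col x = (unfold A).col j := fun j => by
    rw [← Submodule.mem_span_range_iff_exists_fun, hspan, unfold_col]
    exact Submodule.subset_span ⟨_, rfl⟩
  choose c hc using hcol
  refine ⟨fold (Matrix.of fun x j => (c j x).unop), ?_⟩
  funext t
  ext1 i j
  have := congrFun (hc j) (t, i)
  rw [Finset.sum_apply] at this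
  exact this.symm

end QTensor

/-! ### QT-Drazin inverses and QT-Jordan forms of tensors -/

namespace QTensor

variable {n n₃ : ℕ} [NeZero n₃]

theorem isQTDrazinInverse_iff {A X : QTensor n n n₃} :
    IsQTDrazinInverse A X ↔ IsDrazinInverse (dft A) (dft X) (qtIndex A) := by
  constructor
  · rintro ⟨h1, h2, h3⟩
    refine ⟨?_, ?_, ?_⟩
    · rw [← dft_qtPow, ← dft_qtMul', ← dft_qtMul', h1]
    · rw [← dft_qtMul', ← dft_qtMul', h2]
    · rw [← dft_qtMul', ← dft_qtMul', h3]
  · rintro ⟨h1, h2, h3⟩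
    refine ⟨dft_injective ?_, dft_injective ?_, dft_injective ?_⟩
    · rw [dft_qtMul', dft_qtMul', dft_qtPow, h1]
    · rw [dft_qtMul', dft_qtMul', h2]
    · rw [dft_qtMul', dft_qtMul', h3]

/-- Every square quaternion tensor has exactly one QT-Drazin inverse. -/
theorem existsUnique_isQTDrazinInverse (A : QTensor n n n₃) : ∃! X, IsQTDrazinInverse A X := by
  obtain ⟨Y, hY⟩ := exists_qtMul_qtMul_eq (A := qtPow A (qtIndex A)) (B := A)
    (qtRank_qtPow_qtIndex A)
  have h : dft A ^ qtIndex A = dft A ^ (qtIndex A + 1) * dft Y := by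
    have := congrArg dft hY
    rwa [dft_qtMul', dft_qtMul', dft_qtPow, ← pow_succ] at this
  -- `dft Y` need not commute with `dft A`; finite dimension over ℝ allows it to be replaced by an
  -- element that does.
  obtain ⟨y, hc, hy⟩ := exists_commute_pow_eq_pow_succ_mul ℝ h
  obtain ⟨x, hx⟩ := IsDrazinInverse.exists_of_pow_eq_pow_succ_mul hc hy
  refine ⟨idft x, isQTDrazinInverse_iff.mpr (by rwa [dft_idft]), fun Z hZ => dft_injective ?_⟩
  rw [dft_idft]
  exact (isQTDrazinInverse_iff.mp hZ).eq hx

theorem exists_isQTJordanForm (A : QTensor n n n₃) : ∃ J, IsQTJordanForm A J := by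
  choose J hJ using fun s => exists_isJordanForm (dft A s)
  exact ⟨idft J, fun s => by rw [dft_idft]; exact hJ s⟩

/-- A tensor is similar to each of its QT-Jordan forms. -/
theorem IsQTJordanForm.exists_isQTInverse {A J : QTensor n n n₃} (h : IsQTJordanForm A J) :
    ∃ P Q : QTensor n n n₃, IsQTInverse P Q ∧ A = P *Q J *Q Q := by
  choose _ S T hST hTS hA using h
  refine ⟨idft S, idft T, ⟨dft_injective ?_, dft_injective ?_⟩, dft_injective ?_⟩
  · rw [dft_qtMul', dft_idft, dft_idft, dft_qtOne]
    exact funext hST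
  · rw [dft_qtMul', dft_idft, dft_idft, dft_qtOne]
    exact funext hTS
  · rw [dft_qtMul', dft_qtMul', dft_idft, dft_idft]
    exact funext hA

/-- The conjugate of `Y` is a Drazin inverse of `dft A` for the exponent `qtIndex J`. Uniqueness
across different exponents makes it unnecessary to compare the indices of `A` and `J`. -/
theorem IsQTDrazinInverse.eq_conj {A J P Q X Y : QTensor n n n₃} (hPQ : IsQTInverse P Q)
    (hA : A = P *Q J *Q Q) (hX : IsQTDrazinInverse A X) (hY : IsQTDrazinInverse J Y) :
    X = P *Q Y *Q Q := by
  have h1 : dft P * dft Q = 1 := by rw [← dft_qtMul', hPQ.1, dft_qtOne]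
  have h2 : dft Q * dft P = 1 := by rw [← dft_qtMul', hPQ.2, dft_qtOne]
  have h3 := (isQTDrazinInverse_iff.mp hY).conj h1 h2
  rw [← dft_qtMul', ← dft_qtMul', ← dft_qtMul', ← dft_qtMul', ← hA] at h3
  exact dft_injective ((isQTDrazinInverse_iff.mp hX).eq h3)

end QTensor

open scoped QTensor in
theorem mainTheorem4 {n n₃ : ℕ} [NeZero n₃] (A : QTensor n n n₃) :
    (∃ J : QTensor n n n₃, QTensor.IsQTJordanForm A J) ∧
    (∃! X : QTensor n n n₃, QTensor.IsQTDrazinInverse A X) ∧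
    ∀ J : QTensor n n n₃, QTensor.IsQTJordanForm A J →
      (∃! Y : QTensor n n n₃, QTensor.IsQTDrazinInverse J Y) ∧
      ∃ P Pinv : QTensor n n n₃, QTensor.IsQTInverse P Pinv ∧
        A = P *Q J *Q Pinv ∧
        ∀ AD JD : QTensor n n n₃, QTensor.IsQTDrazinInverse A AD →
          QTensor.IsQTDrazinInverse J JD → AD = P *Q JD *Q Pinv := by
  refine ⟨QTensor.exists_isQTJordanForm A, QTensor.existsUnique_isQTDrazinInverse A,
    fun J hJ => ⟨QTensor.existsUnique_isQTDrazinInverse J, ?_⟩⟩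
  obtain ⟨P, Q, hPQ, hA⟩ := hJ.exists_isQTInverse
  exact ⟨P, Q, hPQ, hA, fun _ _ hX hY => hX.eq_conj hPQ hA hY⟩
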